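/- **Definitions.** Identify $\{0,1\}^*$ with $\mathbb N$ through the length-lexicographic correspondence ($\lambda\mapsto 0$, $0\mapsto 1$, $1\mapsto 2$, $00\mapsto 3,\dots$), let $l(p)$ be the length of the string $p$, and let $\chi_A$ be the characteristic function of $A$. For a partial recursive mapping $U:\{0,1\}^*\times\{0,1\}^*\to\{0,1\}^*\cup\{\perp\}$, a set $A\subseteq\{0,1\}^*$ and $x\in\{0,1\}^*$ let $$C_U(x)=\min\{l(p): U(p,\lambda)=x\},$$ $$ic_U(x:A)=\min\{l(p): \lambda z.\,U(p,z)\text{ is a total } A\text{-consistent function with } U(p,x)=\chi_A(x)\},$$ with $\min\emptyset=\infty$, where a partial function $f:\{0,1\}^*\to\{0,1,\perp\}$ is $A$-consistent if $f(z)\in\{\chi_A(z),\perp\}$ for all $z\in\mathrm{dom}(f)$; let $\overline{ic}_U(x:A)$ be defined like $ic_U(x:A)$ without the requirement that $\lambda z.\,U(p,z)$ is total. Such a $U$ is *optimal* if for every partial recursive mapping $U'$ of this kind there is a constant $d$ with $C_U(x)\le C_{U'}(x)+d$, $ic_U(x:A)\le ic_{U'}(x:A)+d$ and $\overline{ic}_U(x:A)\le\overline{ic}_{U'}(x:A)+d$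 for all $x$ and $A$. Fix an optimal $U$ and write $C$, $ic$ for $C_U$, $ic_U$. A set $B$ is *wtt-reducible* to $A$ if there are a Turing reduction $\Phi$ and a total recursive function $g$ such that for all $x$, $\Phi^A(x)=\chi_B(x)$ and every oracle query in the computation of $\Phi^A(x)$ is less than $g(x)$. A set $A$ is *wtt-complete* if $A$ is r.e. and every r.e. set is wtt-reducible to $A$. **Theorem.** For every wtt-complete set $A$ there is a constant $c$ such that $$ic(x:A)\ge C(x)-c\quad\text{for infinitely many } x\in A.$$ -/

import Mathlib

/-- Finite binary strings, the elements of `{0,1}*`. -/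
abbrev Str : Type := List Bool

/-- The canonical (length-lexicographic) correspondence between binary strings and natural numbers:
`λ ↦ 0`, `0 ↦ 1`, `1 ↦ 2`, `00 ↦ 3`, `01 ↦ 4`, … -/
def strNum (x : Str) : ℕ :=
  x.foldl (fun n b => 2 * n + b.toNat + 1) 0

theorem strNum_append_singleton (x : Str) (b : Bool) :
    strNum (x ++ [b]) = 2 * strNum x + b.toNat + 1 := by
  simp [strNum]

/-- The canonical correspondence is indeed a bijection. -/
theorem strNum_bijective : Function.Bijective strNum := by
  constructor
  · intro x
    induction x using List.reverseRecOn with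
    | nil =>
      intro y h
      rcases List.eq_nil_or_concat y with rfl | ⟨y, c, rfl⟩
      · rfl
      · rw [List.concat_eq_append, strNum_append_singleton] at h
        simp [strNum] at h
    | append_singleton x b ih =>
      intro y h
      rcases List.eq_nil_or_concat y with rfl | ⟨y, c, rfl⟩
      · rw [strNum_append_singleton] at h
        simp [strNum] at h
      · rw [List.concat_eq_append, strNum_append_singleton, strNum_append_singleton] at h
        have hb := b.toNat_lt
        have hc := c.toNat_lt
        have h1 : strNum x = strNum y := by omega
        have h2 : b = c := by
          cases b <;> cases c <;> first | rfl | (simp at h; omega)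
        rw [List.concat_eq_append, ih h1, h2]
  · intro n
    induction n using Nat.strong_induction_on with
    | _ n ih =>
      rcases Nat.eq_zero_or_pos n with rfl | hn
      · exact ⟨[], rfl⟩
      · obtain ⟨x, hx⟩ := ih ((n - 1) / 2) (by omega)
        rcases Nat.mod_two_eq_zero_or_one (n - 1) with h | h
        · exact ⟨x ++ [false], by rw [strNum_append_singleton, hx]; simp; omega⟩
        · exact ⟨x ++ [true], by rw [strNum_append_singleton, hx]; simp; omega⟩

open Classical in
/-- The characteristic function of a set; `true` is the value `1` and `false` is the value `0`. -/
noncomputable def chi {α : Type} (A : Set α) (x : α) : Bool :=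
  decide (x ∈ A)

/-! ### Kolmogorov complexity and instance complexity -/

/-- An interpreter: a partial map taking a program and an input to a string or to the
"don't know" symbol, the latter being `none`. -/
abbrev Interpreter : Type := Str → Str →. Option Str

/-- The Kolmogorov complexity of `x` in `U`; it is `⊤` if no program yields `x`. -/
noncomputable def kolmogorov (U : Interpreter) (x : Str) : ℕ∞ :=
  ⨅ (p : Str) (_ : some x ∈ U p []), (p.length : ℕ∞)

/-- `f` is `A`-consistent: each of its values is either "don't know" or the correct value of the
characteristic function of `A` (written as a one-letter string). -/
def AConsistent (A : Set Str) (f : Str →. Option Str) : Prop :=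
  ∀ z, ∀ v ∈ f z, v = some [chi A z] ∨ v = none

/-- The instance complexity of `x` with respect to `A` in `U`. -/
noncomputable def instComplexity (U : Interpreter) (x : Str) (A : Set Str) : ℕ∞ :=
  ⨅ (p : Str) (_ : (∀ z, (U p z).Dom) ∧ AConsistent A (U p) ∧ some [chi A x] ∈ U p x),
    (p.length : ℕ∞)

/-- The weak instance complexity of `x` with respect to `A` in `U`: programs need not be total. -/
noncomputable def weakInstComplexity (U : Interpreter) (x : Str) (A : Set Str) : ℕ∞ :=
  ⨅ (p : Str) (_ : AConsistent A (U p) ∧ some [chi A x] ∈ U p x), (p.length : ℕ∞)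

/-- `U` is partial recursive, and it is optimal up to an additive constant among all partial
recursive interpreters, for Kolmogorov complexity and both kinds of instance complexity. -/
def IsOptimal (U : Interpreter) : Prop :=
  Partrec₂ U ∧ ∀ V : Interpreter, Partrec₂ V → ∃ c : ℕ,
    (∀ x, kolmogorov U x ≤ kolmogorov V x + c) ∧
    (∀ x A, instComplexity U x A ≤ instComplexity V x A + c) ∧
    (∀ x A, weakInstComplexity U x A ≤ weakInstComplexity V x A + c)

/-! ### Turing reductions with bounded use -/

/-- Programs for oracle computations: the codes `Nat.Partrec.Code` for partial recursive functions
with an additional instruction `query`, which asks the oracle about the current input. -/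
inductive OracleCode : Type
  | zero : OracleCode
  | succ : OracleCode
  | left : OracleCode
  | right : OracleCode
  | query : OracleCode
  | pair : OracleCode → OracleCode → OracleCode
  | comp : OracleCode → OracleCode → OracleCode
  | prec : OracleCode → OracleCode → OracleCode
  | rfind' : OracleCode → OracleCode

/-- `Runs A e n b Q`: the computation of the oracle program `e` on input `n` with oracle `A` halts
with output `b`, and `Q` is the set of the numbers about which it queries the oracle. The clauses
other than `query` are those of `Nat.Partrec.Code.eval`. -/
inductive OracleCode.Runs (A : Set ℕ) : OracleCode → ℕ → ℕ → Set ℕ → Prop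
  | zero (n : ℕ) : Runs A .zero n 0 ∅
  | succ (n : ℕ) : Runs A .succ n (n + 1) ∅
  | left (n : ℕ) : Runs A .left n n.unpair.1 ∅
  | right (n : ℕ) : Runs A .right n n.unpair.2 ∅
  | query (n : ℕ) : Runs A .query n (chi A n).toNat {n}
  | pair {f g : OracleCode} {n a b : ℕ} {Q R : Set ℕ} :
      Runs A f n a Q → Runs A g n b R → Runs A (.pair f g) n (Nat.pair a b) (Q ∪ R)
  | comp {f g : OracleCode} {n a b : ℕ} {Q R : Set ℕ} :
      Runs A g n a Q → Runs A f a b R → Runs A (.comp f g) n b (Q ∪ R)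
  | prec_zero {f g : OracleCode} {a b : ℕ} {Q : Set ℕ} :
      Runs A f a b Q → Runs A (.prec f g) (Nat.pair a 0) b Q
  | prec_succ {f g : OracleCode} {a k i b : ℕ} {Q R : Set ℕ} :
      Runs A (.prec f g) (Nat.pair a k) i Q →
      Runs A g (Nat.pair a (Nat.pair k i)) b R →
      Runs A (.prec f g) (Nat.pair a (k + 1)) b (Q ∪ R)
  | rfind_stop {f : OracleCode} {a m : ℕ} {Q : Set ℕ} :
      Runs A f (Nat.pair a m) 0 Q → Runs A (.rfind' f) (Nat.pair a m) m Q
  | rfind_step {f : OracleCode} {a m k b : ℕ} {Q R : Set ℕ} :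
      Runs A f (Nat.pair a m) (k + 1) Q →
      Runs A (.rfind' f) (Nat.pair a (m + 1)) b R →
      Runs A (.rfind' f) (Nat.pair a m) b (Q ∪ R)

/-- `B` is wtt-reducible to `A`: there are a Turing reduction of `B` to `A` and a total recursive
function `g` such that on every input `n` all queries are less than `g n`. -/
def WttReducible (B A : Set ℕ) : Prop :=
  ∃ (e : OracleCode) (g : ℕ → ℕ), Computable g ∧
    ∀ n, ∃ Q : Set ℕ, e.Runs A n (chi B n).toNat Q ∧ ∀ q ∈ Q, q < g n

/-- `A` is wtt-complete: it is r.e. and every r.e. set is wtt-reducible to it. -/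
def WttComplete (A : Set ℕ) : Prop :=
  REPred (fun n => n ∈ A) ∧ ∀ B : Set ℕ, REPred (fun n => n ∈ B) → WttReducible B A

/-! For each n there is an x ∈ A with C(x) ≤ n + c and ic(x : A) ≥ n. Fix n and a bound u. For each
of the 2^n - 1 programs p of length < n, try to list the z < u with U(p, z) = 1, confirming each of
them by an enumeration of A (`exists_partrec_positives`). The list is obtained whenever p is total
and A-consistent, and it never leaves A. The number m < 2^n of lists that are obtained suffices to
compute their union (`exists_partrec_union`). An x ∈ A below u outside the union has ic(x : A) ≥ n,
and searching an enumeration of A for such an x needs only m, written in n bits.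

For a suitable u such an x exists (`WttComplete.exists_partrec_escape`). Otherwise the union is A
below u and answers every query of a wtt-reduction to A with use at most u. Applied to a diagonal
halting set B, this lets a program, given an input k that codes its own index, n and m, predict
whether it halts on k and do the opposite. Bounded use matters because u has to be computed before
the lists. -/

/-! ### Oracle computations with a finite list as oracle -/

/-- The partial function computed by an oracle program whose queries are answered from a finite
list. -/
def OracleCode.evalList (L : List ℕ) : OracleCode → ℕ →. ℕ
  | .zero => fun _ => Part.some 0
  | .succ => fun n => Part.some (n + 1)
  | .left => fun n => Part.some n.unpair.1
  | .right => fun n => Part.some n.unpair.2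
  | .query => fun n => Part.some (if n ∈ L then 1 else 0)
  | .pair f g => fun n =>
      (f.evalList L n).bind fun a => (g.evalList L n).map fun b => Nat.pair a b
  | .comp f g => fun n => (g.evalList L n).bind fun a => f.evalList L a
  | .prec f g => fun n =>
      n.unpair.2.rec (f.evalList L n.unpair.1) fun k ih =>
        ih.bind fun i => g.evalList L (Nat.pair n.unpair.1 (Nat.pair k i))
  | .rfind' f => fun n =>
      (Nat.rfind fun i =>
        (f.evalList L (Nat.pair n.unpair.1 (i + n.unpair.2))).map fun v => decide (v = 0)).map
          fun i => i + n.unpair.2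

theorem primrecRel_list_mem : PrimrecRel fun (n : ℕ) (L : List ℕ) => n ∈ L := by
  have h : PrimrecRel fun (L : List ℕ) (n : ℕ) => ∃ a ∈ L, a = n :=
    PrimrecRel.exists_mem_list Primrec.eq
  have h' : PrimrecRel fun (n : ℕ) (L : List ℕ) => ∃ a ∈ L, a = n := h.comp Primrec.snd Primrec.fst
  exact h'.of_eq fun n L => by simp

theorem OracleCode.partrec_evalList (e : OracleCode) :
    Partrec₂ fun (L : List ℕ) (n : ℕ) => e.evalList L n := by
  have unp : Computable fun p : List ℕ × ℕ => p.2.unpair := Computable.unpair.comp Computable.snd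
  induction e with
  | zero => exact (Computable.const 0).partrec
  | succ => exact (Computable.succ.comp Computable.snd).partrec
  | left => exact (Computable.fst.comp unp).partrec
  | right => exact (Computable.snd.comp unp).partrec
  | query =>
    have h : Primrec fun p : List ℕ × ℕ => if p.2 ∈ p.1 then 1 else 0 :=
      Primrec.ite (primrecRel_list_mem.comp Primrec.snd Primrec.fst)
        (Primrec.const 1) (Primrec.const 0)
    exact h.to_comp.partrec
  | pair f g hf hg =>
    refine Partrec.bind hf ?_
    refine Partrec.map (hg.comp (Computable.fst.comp Computable.fst)
      (Computable.snd.comp Computable.fst)) ?_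
    exact Primrec₂.natPair.to_comp.comp (Computable.snd.comp Computable.fst) Computable.snd
  | comp f g hf hg =>
    exact Partrec.bind hg (hf.comp (Computable.fst.comp Computable.fst) Computable.snd)
  | prec f g hf hg =>
    have step : Partrec₂ fun (p : List ℕ × ℕ) (q : ℕ × ℕ) =>
        g.evalList p.1 (Nat.pair p.2.unpair.1 (Nat.pair q.1 q.2)) := by
      refine hg.comp (Computable.fst.comp Computable.fst) ?_
      refine Primrec₂.natPair.to_comp.comp (Computable.fst.comp (unp.comp Computable.fst)) ?_
      exact Primrec₂.natPair.to_comp.comp (Computable.fst.comp Computable.snd)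
        (Computable.snd.comp Computable.snd)
    exact Partrec.nat_rec (Computable.snd.comp unp)
      (hf.comp Computable.fst (Computable.fst.comp unp)) step
  | rfind' f hf =>
    refine Partrec.map (Partrec.rfind ?_) ?_
    · refine Partrec.map (hf.comp (Computable.fst.comp Computable.fst) ?_) ?_
      · refine Primrec₂.natPair.to_comp.comp (Computable.fst.comp (unp.comp Computable.fst)) ?_
        exact Primrec.nat_add.to_comp.comp Computable.snd
          (Computable.snd.comp (unp.comp Computable.fst))
      · have h : Primrec fun v : ℕ => decide (v = 0) :=
          (Primrec.eq.comp Primrec.id (Primrec.const 0)).decide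
        exact h.to_comp.comp Computable.snd
    · exact Primrec.nat_add.to_comp.comp Computable.snd
        (Computable.snd.comp (unp.comp Computable.fst))

/-- Only the queries actually asked matter, so agreement of the list with `A` on `Q` suffices. -/
theorem OracleCode.Runs.mem_evalList {A : Set ℕ} {e : OracleCode} {n b : ℕ} {Q : Set ℕ}
    (h : e.Runs A n b Q) {L : List ℕ} (hL : ∀ q ∈ Q, q ∈ L ↔ q ∈ A) : b ∈ e.evalList L n := by
  induction h with
  | zero n => simp [evalList]
  | succ n => simp [evalList]
  | left n => simp [evalList]
  | right n => simp [evalList]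
  | query n =>
    have := hL n rfl
    by_cases hn : n ∈ A <;> simp [evalList, chi, hn, this]
  | pair _ _ hf hg =>
    simp only [evalList, Part.mem_bind_iff, Part.mem_map_iff]
    exact ⟨_, hf fun q hq => hL q (Or.inl hq), _, hg fun q hq => hL q (Or.inr hq), rfl⟩
  | comp _ _ hg hf =>
    simp only [evalList, Part.mem_bind_iff]
    exact ⟨_, hg fun q hq => hL q (Or.inl hq), hf fun q hq => hL q (Or.inr hq)⟩
  | prec_zero _ hf => simpa [evalList] using hf hL
  | prec_succ _ _ h1 h2 =>
    have h1 := h1 fun q hq => hL q (Or.inl hq)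
    have h2 := h2 fun q hq => hL q (Or.inr hq)
    simp only [evalList, Nat.unpair_pair, Part.mem_bind_iff] at h1 ⊢
    exact ⟨_, h1, h2⟩
  | rfind_stop _ h =>
    have h := h hL
    simp only [evalList, Nat.unpair_pair]
    refine (Part.mem_map_iff _).2 ⟨0, Nat.mem_rfind.2 ⟨?_, by simp⟩, by simp⟩
    exact (Part.mem_map_iff _).2 ⟨0, by simpa using h, by simp⟩
  | @rfind_step f a m k b _ _ _ _ h1 h2 =>
    have h1 := h1 fun q hq => hL q (Or.inl hq)
    have h2 := h2 fun q hq => hL q (Or.inr hq)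
    simp only [evalList, Nat.unpair_pair] at h2 ⊢
    obtain ⟨i, hi, rfl⟩ := (Part.mem_map_iff _).1 h2
    obtain ⟨hi, hlt⟩ := Nat.mem_rfind.1 hi
    refine (Part.mem_map_iff _).2 ⟨i + 1, Nat.mem_rfind.2 ⟨?_, ?_⟩, by omega⟩
    · rwa [show i + 1 + m = i + (m + 1) by omega]
    · intro j hj
      cases j with
      | zero => exact (Part.mem_map_iff _).2 ⟨k + 1, by simpa using h1, by simp⟩
      | succ j =>
        rw [show j + 1 + m = j + (m + 1) by omega]
        exact hlt (by omega)

/-! ### Unions of partially defined lists -/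

open Nat.Partrec (Code) in
/-- From a uniformly partial recursive family of lists `T j u`, `j < N`, one obtains their union
from the number of those lists that are defined. -/
theorem exists_partrec_union {T : ℕ → ℕ →. List ℕ} (hT : Partrec₂ T) :
    ∃ K : ℕ × ℕ → ℕ →. List ℕ, Partrec₂ K ∧
      (∀ N u m, ∀ l ∈ K (N, u) m, ∀ z ∈ l, ∃ j < N, ∃ l' ∈ T j u, z ∈ l') ∧
      ∀ N u, ∃ m ≤ N, ∃ l ∈ K (N, u) m, ∀ j < N, ∀ l' ∈ T j u, ∀ z ∈ l', z ∈ l := by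
  have hT' : Nat.Partrec fun k => (T k.unpair.1 k.unpair.2).map Encodable.encode :=
    Partrec.nat_iff.1 <| Partrec.map_encode_iff.2 <|
      hT.comp (Computable.fst.comp Computable.unpair) (Computable.snd.comp Computable.unpair)
  obtain ⟨c, hc⟩ := Code.exists_code.1 hT'
  have eval_iff : ∀ j u v, v ∈ c.eval (Nat.pair j u) ↔ ∃ l ∈ T j u, Encodable.encode l = v := by
    intro j u v
    rw [hc]
    simp
  let H : ℕ × ℕ → ℕ → List ℕ := fun p s =>
    (List.range p.1).filterMap fun j => Code.evaln s c (Nat.pair j p.2)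
  have hH : Primrec₂ H := by
    refine Primrec.listFilterMap (Primrec.list_range.comp (Primrec.fst.comp Primrec.fst)) ?_
    refine Code.primrec_evaln.comp (((Primrec.snd.comp Primrec.fst).pair
      (Primrec.const c)).pair ?_)
    exact Primrec₂.natPair.comp Primrec.snd
      (Primrec.snd.comp (Primrec.fst.comp Primrec.fst))
  let S : ℕ × ℕ → ℕ → Finset ℕ := fun p s =>
    (Finset.range p.1).filter fun j => (Code.evaln s c (Nat.pair j p.2)).isSome
  have hS : ∀ p s, (H p s).length = (S p s).card := by
    intro p s
    simp only [H, S, List.length_filterMap_eq_countP, List.countP_eq_length_filter]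
    simp [Finset.card, Finset.filter, Multiset.range]
  let R : List ℕ → List ℕ := fun L =>
    L.flatMap fun v => (Encodable.decode (α := List ℕ) v).getD []
  have hR : Primrec R :=
    Primrec.list_flatMap Primrec.id
      (Primrec.option_getD.comp (Primrec.decode.comp Primrec.snd) (Primrec.const []))
  have memR : ∀ p s z, z ∈ R (H p s) ↔
      ∃ j < p.1, ∃ v ∈ Code.evaln s c (Nat.pair j p.2),
        z ∈ (Encodable.decode (α := List ℕ) v).getD [] := by
    intro p s z
    simp only [R, H, List.mem_flatMap, List.mem_filterMap, List.mem_range, Option.mem_def]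
    constructor
    · rintro ⟨v, ⟨j, hj, hv⟩, hz⟩
      exact ⟨j, hj, v, hv, hz⟩
    · rintro ⟨j, hj, v, hv, hz⟩
      exact ⟨v, ⟨j, hj, hv⟩, hz⟩
  refine ⟨fun p m => (Nat.rfind fun s => Part.some (decide (m ≤ (H p s).length))).map
    fun s => R (H p s), ?_, ?_, ?_⟩
  · refine Partrec.map (Partrec.rfind ?_) ?_
    · have h : PrimrecPred fun q : ((ℕ × ℕ) × ℕ) × ℕ => q.1.2 ≤ (H q.1.1 q.2).length :=
        Primrec.nat_le.comp (Primrec.snd.comp Primrec.fst) (Primrec.list_length.comp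
          (hH.comp (Primrec.fst.comp Primrec.fst) Primrec.snd))
      exact h.decide.to_comp.partrec
    · exact (hR.comp (hH.comp (Primrec.fst.comp Primrec.fst) Primrec.snd)).to_comp
  · intro N u m l hl z hz
    obtain ⟨s, -, rfl⟩ := (Part.mem_map_iff _).1 hl
    obtain ⟨j, hj, v, hv, hz⟩ := (memR _ _ _).1 hz
    obtain ⟨l', hl', rfl⟩ := (eval_iff _ _ _).1 (Code.evaln_sound hv)
    exact ⟨j, hj, l', hl', by simpa using hz⟩
  · intro N u
    classical
    let D : Finset ℕ := (Finset.range N).filter fun j => (c.eval (Nat.pair j u)).Dom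
    have hSD : ∀ s, S (N, u) s ⊆ D := by
      intro s j hj
      simp only [S, D, Finset.mem_filter] at hj ⊢
      obtain ⟨v, hv⟩ := Option.isSome_iff_exists.1 hj.2
      exact ⟨hj.1, Part.dom_iff_mem.2 ⟨v, Code.evaln_sound hv⟩⟩
    have hconv : ∀ j ∈ D, ∃ s, (Code.evaln s c (Nat.pair j u)).isSome := by
      intro j hj
      obtain ⟨v, hv⟩ := Part.dom_iff_mem.1 (Finset.mem_filter.1 hj).2
      obtain ⟨s, hs⟩ := Code.evaln_complete.1 hv
      exact ⟨s, Option.isSome_iff_exists.2 ⟨v, hs⟩⟩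
    choose! t ht using hconv
    have hlast : D ⊆ S (N, u) (D.sup t) := by
      intro j hj
      obtain ⟨v, hv⟩ := Option.isSome_iff_exists.1 (ht j hj)
      exact Finset.mem_filter.2 ⟨(Finset.mem_filter.1 hj).1,
        Option.isSome_iff_exists.2 ⟨v, Code.evaln_mono (Finset.le_sup hj) hv⟩⟩
    -- For m = |D| the search stops, since every computation in `D` has halted by stage `D.sup t`.
    obtain ⟨s, hs, -⟩ := Nat.rfind_min' (p := fun s => decide (D.card ≤ (H (N, u) s).length))
      (m := D.sup t) (by simpa [hS] using Finset.card_le_card hlast)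
    refine ⟨D.card, (Finset.card_filter_le _ _).trans (by simp), R (H (N, u) s),
      Part.mem_map _ hs, ?_⟩
    intro j hj l hl z hz
    have hcard : D.card ≤ (S (N, u) s).card := by
      have := Nat.rfind_spec hs
      simpa [hS] using this
    have hjD : j ∈ D := Finset.mem_filter.2 ⟨Finset.mem_range.2 hj,
      Part.dom_iff_mem.2 ⟨_, (eval_iff j u _).2 ⟨l, hl, rfl⟩⟩⟩
    -- The halted indices form a subset of `D` with at least |D| elements, so no list is missed.
    rw [← Finset.eq_of_subset_of_card_le (hSD s) hcard] at hjD
    obtain ⟨v, hv⟩ := Option.isSome_iff_exists.1 (Finset.mem_filter.1 hjD).2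
    obtain ⟨l', hl', rfl⟩ := (eval_iff _ _ _).1 (Code.evaln_sound hv)
    cases Part.mem_unique hl hl'
    exact (memR _ _ _).2 ⟨j, hj, _, hv, by simpa using hz⟩

/-! ### Completeness yields elements outside the lists -/

/-- The partial sums of `g` serve as `h`. -/
theorem Computable.exists_running_bound {g : ℕ → ℕ} (hg : Computable g) :
    ∃ h : ℕ → ℕ, Computable h ∧ ∀ i k, i ≤ k → g i ≤ h k := by
  have step : Computable₂ fun (_ : ℕ) (p : ℕ × ℕ) => p.2 + g (p.1 + 1) :=
    Primrec.nat_add.to_comp.comp (Computable.snd.comp Computable.snd)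
      (hg.comp (Computable.succ.comp (Computable.fst.comp Computable.snd)))
  refine ⟨fun k => Nat.rec (g 0) (fun j r => r + g (j + 1)) k,
    Computable.nat_rec Computable.id (Computable.const (g 0)) step, ?_⟩
  intro i k hik
  induction k with
  | zero =>
    obtain rfl : i = 0 := by omega
    exact le_rfl
  | succ k ih =>
    rcases Nat.le_succ_iff.1 hik with h | rfl
    · exact (ih h).trans (Nat.le_add_right _ _)
    · exact Nat.le_add_left _ _

theorem primrec_two_pow : Primrec fun n : ℕ => 2 ^ n := by
  have step : Primrec₂ fun (_ : ℕ) (p : ℕ × ℕ) => 2 * p.2 :=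
    Primrec.nat_mul.comp (Primrec.const 2) (Primrec.snd.comp Primrec.snd)
  have h : Primrec fun n : ℕ => (Nat.rec 1 (fun _ r => 2 * r) n : ℕ) :=
    Primrec.nat_rec' Primrec.id (Primrec.const 1) step
  refine h.of_eq fun n => ?_
  induction n with
  | zero => rfl
  | succ n ih => rw [pow_succ, ← ih, mul_comm]

open Nat.Partrec (Code) in
theorem primrec_search_not_mem (c : Code) :
    Primrec fun r : (ℕ × List ℕ) × ℕ =>
      if (r.2.unpair.1 < r.1.1 ∧ r.2.unpair.1 ∉ r.1.2) ∧
        (Code.evaln r.2.unpair.2 c r.2.unpair.1).isSome = true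
      then some r.2.unpair.1 else none := by
  have t1 : Primrec fun r : (ℕ × List ℕ) × ℕ => r.2.unpair.1 :=
    Primrec.fst.comp (Primrec.unpair.comp Primrec.snd)
  have t2 : Primrec fun r : (ℕ × List ℕ) × ℕ => r.2.unpair.2 :=
    Primrec.snd.comp (Primrec.unpair.comp Primrec.snd)
  have h1 : PrimrecPred fun r : (ℕ × List ℕ) × ℕ => r.2.unpair.1 < r.1.1 :=
    Primrec.nat_lt.comp t1 (Primrec.fst.comp Primrec.fst)
  have h2 : PrimrecPred fun r : (ℕ × List ℕ) × ℕ => r.2.unpair.1 ∈ r.1.2 :=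
    primrecRel_list_mem.comp t1 (Primrec.snd.comp Primrec.fst)
  have h3 : Primrec fun r : (ℕ × List ℕ) × ℕ =>
      (Code.evaln r.2.unpair.2 c r.2.unpair.1).isSome :=
    Primrec.option_isSome.comp (Code.primrec_evaln.comp ((t2.pair (Primrec.const c)).pair t1))
  exact Primrec.ite ((h1.and h2.not).and (Primrec.eq.comp h3 (Primrec.const true)))
    (Primrec.option_some.comp t1) (Primrec.const none)

open Nat.Partrec (Code) in
-- The search runs over pairs of a candidate and a number of steps within which its membership in
-- `A` is confirmed.
theorem REPred.exists_partrec_search {A : Set ℕ} (hA : REPred fun n => n ∈ A) :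
    ∃ S : ℕ × List ℕ →. ℕ, Partrec S ∧
      (∀ v l, ∀ x ∈ S (v, l), x ∈ A ∧ x < v ∧ x ∉ l) ∧
      ∀ v l, (∃ x ∈ A, x < v ∧ x ∉ l) → (S (v, l)).Dom := by
  obtain ⟨c, hc⟩ := Code.exists_code.1 <| Partrec.nat_iff.1 <|
    Partrec.map hA (Computable.const 0).to₂
  have c_dom : ∀ x, (c.eval x).Dom ↔ x ∈ A := by
    intro x
    rw [hc]
    simp [Part.assert]
  refine ⟨_, Partrec.rfindOpt (primrec_search_not_mem c).to_comp.to₂, ?_, ?_⟩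
  · intro v l x hx
    obtain ⟨t, ht⟩ := Nat.rfindOpt_spec hx
    simp only [Option.mem_def, Option.ite_none_right_eq_some, Option.some.injEq] at ht
    obtain ⟨⟨⟨htv, htl⟩, hts⟩, rfl⟩ := ht
    obtain ⟨w, hw⟩ := Option.isSome_iff_exists.1 hts
    exact ⟨(c_dom _).1 (Part.dom_iff_mem.2 ⟨w, Code.evaln_sound hw⟩), htv, htl⟩
  · rintro v l ⟨x, hxA, hxv, hxl⟩
    obtain ⟨w, hw⟩ := Part.dom_iff_mem.1 ((c_dom x).2 hxA)
    obtain ⟨s, hs⟩ := Code.evaln_complete.1 hw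
    exact Nat.rfindOpt_dom.2 ⟨Nat.pair x s, x, by simp [hxv, hxl, Option.mem_def.1 hs]⟩

open Nat.Partrec (Code) in
/-- A wtt-complete set `A` has, for each `n`, an element below a bound `u n` that lies in none of
the sublists `T j (u n)` of `A`, `j < 2 ^ n - 1`, and is computable from `n` and a number
`m < 2 ^ n`. -/
theorem WttComplete.exists_partrec_escape {A : Set ℕ} (hA : WttComplete A) {T : ℕ → ℕ →. List ℕ}
    (hT : Partrec₂ T) (hTA : ∀ j u, ∀ l ∈ T j u, ∀ z ∈ l, z ∈ A) :
    ∃ X : ℕ → ℕ →. ℕ, Partrec₂ X ∧ ∃ u : ℕ → ℕ, ∀ n, ∃ m < 2 ^ n, ∃ x ∈ X n m,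
      x ∈ A ∧ x < u n ∧ ∀ j, j < 2 ^ n - 1 → ∀ l ∈ T j (u n), x ∉ l := by
  obtain ⟨K, hK, hKsub, hKfull⟩ := exists_partrec_union hT
  -- The first component of k is a program index and all of k is its input, so a program can read
  -- its own index and no recursion theorem is needed.
  let B : Set ℕ := {k | ((Denumerable.ofNat Code k.unpair.1).eval k).Dom}
  have hB : REPred fun k => k ∈ B :=
    (Code.eval_part.comp ((Computable.ofNat Code).comp (Computable.fst.comp Computable.unpair))
      Computable.id).dom_re
  obtain ⟨e, g, hg, hred⟩ := hA.2 B hB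
  obtain ⟨h, hh, hgh⟩ := hg.exists_running_bound
  -- This bounds the use on ⟨q, ⟨n, m⟩⟩ for all m ≤ 2^n at once; u cannot depend on m, which counts
  -- lists that depend on u.
  let u : ℕ → ℕ → ℕ := fun q n => h (Nat.pair q (Nat.pair n (2 ^ n)))
  have hu : Computable₂ u := by
    refine hh.comp (Primrec₂.natPair.comp Primrec.fst (Primrec₂.natPair.comp Primrec.snd ?_)).to_comp
    exact primrec_two_pow.comp Primrec.snd
  have hN : Computable fun n : ℕ => 2 ^ n - 1 :=
    (Primrec.nat_sub.comp primrec_two_pow (Primrec.const 1)).to_comp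
  -- On k = ⟨q, ⟨n, m⟩⟩, run the reduction of `B` with the union as oracle and halt exactly when it
  -- answers that k is not in `B`.
  let D : ℕ →. ℕ := fun k =>
    (K (2 ^ k.unpair.2.unpair.1 - 1, u k.unpair.1 k.unpair.2.unpair.1) k.unpair.2.unpair.2).bind
      fun l => (e.evalList l k).bind fun b => ((if b = 0 then some 0 else none : Option ℕ) : Part ℕ)
  have hD : Partrec D := by
    have c1 : Computable fun k : ℕ => k.unpair.1 := Computable.fst.comp Computable.unpair
    have c2 : Computable fun k : ℕ => k.unpair.2 := Computable.snd.comp Computable.unpair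
    have c21 : Computable fun k : ℕ => k.unpair.2.unpair.1 := c1.comp c2
    have c22 : Computable fun k : ℕ => k.unpair.2.unpair.2 := c2.comp c2
    refine Partrec.bind (hK.comp ((hN.comp c21).pair (hu.comp c1 c21)) c22) ?_
    refine Partrec.bind (e.partrec_evalList.comp Computable.snd Computable.fst) ?_
    refine Computable.ofOption (Primrec.to_comp ?_)
    exact Primrec.ite (Primrec.eq.comp Primrec.snd (Primrec.const 0)) (Primrec.const _)
      (Primrec.const _)
  obtain ⟨c, hc⟩ := Code.exists_code.1 (Partrec.nat_iff.1 hD)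
  obtain ⟨q, hq⟩ : ∃ q, Denumerable.ofNat Code q = c := ⟨Encodable.encode c, by simp⟩
  have escape : ∀ n m l, m ≤ 2 ^ n → l ∈ K (2 ^ n - 1, u q n) m → ∃ x ∈ A, x < u q n ∧ x ∉ l := by
    intro n m l hm hl
    by_contra! hcon
    have hlA : ∀ z ∈ l, z ∈ A := by
      intro z hz
      obtain ⟨j, -, l', hl', hz'⟩ := hKsub _ _ _ l hl z hz
      exact hTA _ _ _ hl' _ hz'
    obtain ⟨k, hk⟩ : ∃ k, k = Nat.pair q (Nat.pair n m) := ⟨_, rfl⟩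
    obtain ⟨Q, hrun, hQ⟩ := hred k
    have hgu : g k ≤ u q n := by
      refine hgh _ _ ?_
      subst hk
      rcases hm.lt_or_eq with hm | rfl
      · exact (Nat.pair_lt_pair_right _ (Nat.pair_lt_pair_right _ hm)).le
      · exact le_rfl
    -- By `hcon`, the list l agrees with `A` below u, hence on all queries.
    have hmem := hrun.mem_evalList (L := l) fun x hx =>
      ⟨hlA x, fun hxA => hcon x hxA ((hQ x hx).trans_le hgu)⟩
    have hBk : k ∈ B ↔ (D k).Dom := by
      simp only [B, Set.mem_ofPred_eq]
      rw [show k.unpair.1 = q by simp [hk], hq, hc]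
    have hDk : D k = ((if (chi B k).toNat = 0 then some 0 else none : Option ℕ) : Part ℕ) := by
      simp only [D]
      rw [show k.unpair.1 = q by simp [hk], show k.unpair.2.unpair.1 = n by simp [hk],
        show k.unpair.2.unpair.2 = m by simp [hk], Part.eq_some_iff.2 hl, Part.bind_some,
        Part.eq_some_iff.2 hmem, Part.bind_some]
    by_cases hkB : k ∈ B
    · have := hBk.1 hkB
      rw [hDk] at this
      simp [chi, hkB] at this
    · refine hkB (hBk.2 ?_)
      rw [hDk]
      simp [chi, hkB]
  obtain ⟨S, hS, hSspec, hSdom⟩ := hA.1.exists_partrec_search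
  refine ⟨fun n m => (K (2 ^ n - 1, u q n) m).bind fun l => S (u q n, l), ?_, u q, fun n => ?_⟩
  · have cu : Computable fun n : ℕ => u q n := hu.comp (Computable.const q) Computable.id
    refine Partrec.bind (hK.comp ((hN.comp Computable.fst).pair (cu.comp Computable.fst))
      Computable.snd) ?_
    exact hS.comp ((cu.comp (Computable.fst.comp Computable.fst)).pair Computable.snd)
  · obtain ⟨m, hm, l, hl, hfull⟩ := hKfull (2 ^ n - 1) (u q n)
    have hpos := Nat.two_pow_pos n
    have hm : m < 2 ^ n := by omega
    obtain ⟨x, hx⟩ := Part.dom_iff_mem.1 (hSdom _ _ (escape n m l hm.le hl))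
    obtain ⟨hxA, hxu, hxl⟩ := hSspec _ _ x hx
    exact ⟨m, hm, x, Part.mem_bind hl hx, hxA, hxu,
      fun j hj l' hl' hmem => hxl (hfull j hj l' hl' _ hmem)⟩

/-! ### Strings and their numbers -/

theorem primrec_strNum : Primrec strNum := by
  have h : Primrec₂ fun (_ : Str) (p : ℕ × Bool) => 2 * p.1 + p.2.toNat + 1 := by
    have hp : Primrec fun r : Str × ℕ × Bool => 2 * r.2.1 :=
      Primrec.nat_mul.comp (Primrec.const 2) (Primrec.fst.comp Primrec.snd)
    have hb : Primrec fun r : Str × ℕ × Bool => r.2.2.toNat :=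
      (Primrec.dom_finite Bool.toNat).comp (Primrec.snd.comp Primrec.snd)
    exact Primrec.succ.comp (Primrec.nat_add.comp hp hb)
  exact Primrec.list_foldl Primrec.id (Primrec.const 0) h

/-- The length-lexicographic correspondence as an equivalence. -/
noncomputable def strEquiv : Str ≃ ℕ := Equiv.ofBijective strNum strNum_bijective

@[simp] theorem strNum_strEquiv_symm (n : ℕ) : strNum (strEquiv.symm n) = n :=
  strEquiv.apply_symm_apply n

@[simp] theorem strEquiv_symm_strNum (x : Str) : strEquiv.symm (strNum x) = x :=
  strEquiv.symm_apply_apply x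

theorem strEquiv_symm_mem {A : Set Str} {n : ℕ} : strEquiv.symm n ∈ A ↔ n ∈ strNum '' A :=
  ⟨fun h => ⟨_, h, by simp⟩, by rintro ⟨x, hx, rfl⟩; simpa using hx⟩

theorem computable_strEquiv_symm : Computable (strEquiv.symm : ℕ → Str) := by
  have h : Primrec₂ fun (n k : ℕ) => (Encodable.decode (α := Str) k).bind fun x =>
      if strNum x = n then some x else none := by
    refine Primrec.option_bind (Primrec.decode.comp Primrec.snd) ?_
    exact Primrec.ite (Primrec.eq.comp (primrec_strNum.comp Primrec.snd)
      (Primrec.fst.comp Primrec.fst)) (Primrec.option_some.comp Primrec.snd) (Primrec.const none)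
  refine (Partrec.rfindOpt h.to_comp).of_eq_tot fun n => ?_
  obtain ⟨x, hx⟩ := Part.dom_iff_mem.1 <| Nat.rfindOpt_dom.2
    (show ∃ k x, x ∈ (Encodable.decode (α := Str) k).bind fun x =>
        if strNum x = n then some x else none from
      ⟨Encodable.encode (strEquiv.symm n), strEquiv.symm n, by simp⟩)
  obtain ⟨k, hk⟩ := Nat.rfindOpt_spec hx
  simp only [Option.mem_def, Option.bind_eq_some_iff, Option.ite_none_right_eq_some,
    Option.some.injEq] at hk
  obtain ⟨y, -, rfl, rfl⟩ := hk
  simpa using hx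

/-- The strings of length n occupy the numbers from 2^n - 1 to 2^(n+1) - 2, so those of length < n
are exactly the ones numbered below 2^n - 1. -/
theorem two_pow_length_le (x : Str) :
    2 ^ x.length ≤ strNum x + 1 ∧ strNum x + 1 < 2 ^ (x.length + 1) := by
  induction x using List.reverseRecOn with
  | nil => simp [strNum]
  | append_singleton x b ih =>
    have hb := b.toNat_lt
    rw [strNum_append_singleton, List.length_append, List.length_singleton]
    simp only [pow_succ] at ih ⊢
    omega

theorem length_eq_of_strNum {x : Str} {n m : ℕ} (hm : m < 2 ^ n) (hx : strNum x + 1 = 2 ^ n + m) :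
    x.length = n := by
  obtain ⟨h1, h2⟩ := two_pow_length_le x
  have h3 : 2 ^ x.length < 2 ^ (n + 1) := by rw [pow_succ]; omega
  have h4 : 2 ^ n < 2 ^ (x.length + 1) := by omega
  have h5 := (Nat.pow_lt_pow_iff_right (by norm_num)).1 h3
  have h6 := (Nat.pow_lt_pow_iff_right (by norm_num)).1 h4
  omega

/-! ### Lists of accepted inputs -/

/-- For a partial recursive `f` and an r.e. set `A`, the lists of all `z < u` with `f j z = true`
can be computed whenever `f j` is defined below `u` and these `z` lie in `A`. -/
theorem exists_partrec_positives {f : ℕ → ℕ →. Bool} (hf : Partrec₂ f) {A : Set ℕ}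
    (hA : REPred fun n => n ∈ A) :
    ∃ T : ℕ → ℕ →. List ℕ, Partrec₂ T ∧ (∀ j u, ∀ l ∈ T j u, ∀ z ∈ l, z ∈ A) ∧
      ∀ j u, (∀ z < u, (f j z).Dom ∧ (true ∈ f j z → z ∈ A)) →
        ∃ l ∈ T j u, ∀ z < u, true ∈ f j z → z ∈ l := by
  -- An accepted input is added only after it is enumerated into `A`; if it is not in `A`, the
  -- computation diverges.
  let step : ℕ → ℕ × List ℕ →. List ℕ := fun j p => (f j p.1).bind fun v =>
    cond v ((Part.assert (p.1 ∈ A) fun _ => Part.some ()).map fun _ => p.1 :: p.2) (Part.some p.2)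
  have hstep : Partrec₂ step := by
    refine Partrec.bind (hf.comp Computable.fst (Computable.fst.comp Computable.snd)) ?_
    refine Partrec.cond Computable.snd ?_
      (Computable.snd.comp (Computable.snd.comp Computable.fst)).partrec
    have c : Computable fun r : (ℕ × ℕ × List ℕ) × Bool => r.1.2.1 :=
      Computable.fst.comp (Computable.snd.comp Computable.fst)
    refine Partrec.map (hA.comp c) ?_
    exact Computable.list_cons.comp (c.comp Computable.fst)
      (Computable.snd.comp (Computable.snd.comp (Computable.fst.comp Computable.fst)))
  let T : ℕ → ℕ →. List ℕ := fun j u =>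
    Nat.rec (Part.some []) (fun z ih => ih.bind fun l => step j (z, l)) u
  have hT : Partrec₂ T := by
    have h : Partrec₂ fun (r : ℕ × ℕ) (p : ℕ × List ℕ) => step r.1 p :=
      hstep.comp (Computable.fst.comp Computable.fst) Computable.snd
    exact Partrec.nat_rec Computable.snd (Computable.const []).partrec h
  have T_succ : ∀ j u, T j (u + 1) = (T j u).bind fun l => step j (u, l) := fun _ _ => rfl
  refine ⟨T, hT, fun j u => ?_, fun j u => ?_⟩
  · induction u with
    | zero =>
      intro l hl
      obtain rfl : l = [] := Part.mem_some_iff.1 hl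
      simp
    | succ u ih =>
      intro l hl z hz
      rw [T_succ] at hl
      obtain ⟨l', hl', hl⟩ := Part.mem_bind_iff.1 hl
      obtain ⟨v, -, hl⟩ := Part.mem_bind_iff.1 hl
      cases v with
      | false =>
        obtain rfl : l = l' := Part.mem_some_iff.1 hl
        exact ih l hl' z hz
      | true =>
        obtain ⟨_, hu, rfl⟩ := (Part.mem_map_iff _).1 hl
        have hu := (Part.mem_assert_iff.1 hu).fst
        rcases List.mem_cons.1 hz with rfl | hz
        · exact hu
        · exact ih l' hl' z hz
  · induction u with
    | zero => exact fun _ => ⟨[], Part.mem_some _, by simp⟩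
    | succ u ih =>
      intro h
      obtain ⟨l, hl, hall⟩ := ih fun z hz => h z (by omega)
      obtain ⟨hdom, hu⟩ := h u (by omega)
      obtain ⟨v, hv⟩ := Part.dom_iff_mem.1 hdom
      rw [T_succ]
      cases v with
      | false =>
        refine ⟨l, Part.mem_bind hl (Part.mem_bind hv (Part.mem_some _)), fun z hz hfz => ?_⟩
        rcases Nat.lt_succ_iff_lt_or_eq.1 hz with hz | rfl
        · exact hall z hz hfz
        · cases Part.mem_unique hv hfz
      | true =>
        refine ⟨u :: l, Part.mem_bind hl (Part.mem_bind hv ((Part.mem_map_iff _).2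
          ⟨(), Part.mem_assert_iff.2 ⟨hu hv, Part.mem_some _⟩, rfl⟩)), fun z hz hfz => ?_⟩
        rcases Nat.lt_succ_iff_lt_or_eq.1 hz with hz | rfl
        · exact List.mem_cons_of_mem _ (hall z hz hfz)
        · exact List.mem_cons_self

/-! ### The theorem -/

/-- Compare with the interpreter whose program x answers 1 on x and "don't know" elsewhere. -/
theorem IsOptimal.instComplexity_ne_top {U : Interpreter} (hU : IsOptimal U) {A : Set Str} {x : Str}
    (hx : x ∈ A) : instComplexity U x A ≠ ⊤ := by
  let V : Interpreter := fun p z => Part.some (if p = z then some [true] else none)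
  have hV : Partrec₂ V := by
    have h : Primrec fun r : Str × Str => if r.1 = r.2 then some [true] else none :=
      Primrec.ite (Primrec.eq.comp Primrec.fst Primrec.snd) (Primrec.const _) (Primrec.const _)
    exact h.to_comp.partrec
  obtain ⟨c, -, hc, -⟩ := hU.2 V hV
  have hle : instComplexity V x A ≤ x.length := by
    refine iInf₂_le x ⟨fun _ => trivial, fun z v hv => ?_, ?_⟩
    · obtain rfl := Part.mem_some_iff.1 hv
      by_cases h : x = z
      · subst h
        simp [chi, hx]
      · simp [h]
    · simp [V, chi, hx]
  refine ne_top_of_le_ne_top ?_ ((hc x A).trans (add_le_add_left hle _))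
  exact ENat.natCast_ne_top (x.length + c)

theorem mainTheorem5 (U : Interpreter) (hU : IsOptimal U)
    (A : Set Str) (hA : WttComplete (strNum '' A)) :
    ∃ c : ℕ, {x : Str | x ∈ A ∧ kolmogorov U x ≤ instComplexity U x A + c}.Infinite := by
  let f : ℕ → ℕ →. Bool := fun j z =>
    (U (strEquiv.symm j) (strEquiv.symm z)).map fun v => decide (v = some [true])
  have hf : Partrec₂ f := by
    refine Partrec.map (hU.1.comp (computable_strEquiv_symm.comp Computable.fst)
      (computable_strEquiv_symm.comp Computable.snd)) ?_
    have h : Primrec fun v : Option Str => decide (v = some [true]) :=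
      (Primrec.eq.comp Primrec.id (Primrec.const _)).decide
    exact h.to_comp.comp Computable.snd
  obtain ⟨T, hT, hTA, hTf⟩ := exists_partrec_positives hf hA.1
  obtain ⟨X, hX, u, hXu⟩ := hA.exists_partrec_escape hT hTA
  -- The length of p gives n, and the position of p among the strings of that length gives m.
  let W : Interpreter := fun p _ =>
    (X p.length (strNum p + 1 - 2 ^ p.length)).map fun x => some (strEquiv.symm x)
  have hW : Partrec₂ W := by
    have hlen : Primrec fun p : Str => p.length := Primrec.list_length
    have harg : Primrec fun p : Str => strNum p + 1 - 2 ^ p.length :=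
      Primrec.nat_sub.comp (Primrec.succ.comp primrec_strNum) (primrec_two_pow.comp hlen)
    refine Partrec.map (hX.comp (hlen.to_comp.comp Computable.fst)
      (harg.to_comp.comp Computable.fst)) ?_
    exact Computable.option_some.comp (computable_strEquiv_symm.comp Computable.snd)
  obtain ⟨c, hc, -⟩ := hU.2 W hW
  have key : ∀ n : ℕ, ∃ x ∈ A, kolmogorov U x ≤ n + c ∧ (n : ℕ∞) ≤ instComplexity U x A := by
    intro n
    obtain ⟨m, hm, x, hx, hxA, hxu, hxT⟩ := hXu n
    have hpos := Nat.two_pow_pos n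
    refine ⟨strEquiv.symm x, strEquiv_symm_mem.2 hxA, ?_, ?_⟩
    · obtain ⟨w, hw⟩ : ∃ w : Str, strNum w = 2 ^ n - 1 + m := strNum_bijective.2 _
      have hw : strNum w + 1 = 2 ^ n + m := by omega
      have hlen := length_eq_of_strNum hm hw
      refine (hc _).trans (add_le_add_left ?_ _)
      rw [← hlen]
      refine iInf₂_le w (Part.mem_map _ ?_)
      rw [hw, hlen, Nat.add_sub_cancel_left]
      exact hx
    · refine le_iInf₂ fun p hp => ?_
      obtain ⟨htot, hcons, hpx⟩ := hp
      by_contra hlt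
      have hlt : p.length + 1 ≤ n := by simpa using hlt
      have hj : strNum p < 2 ^ n - 1 := by
        have h1 := (two_pow_length_le p).2
        have h2 := Nat.pow_le_pow_right (n := 2) (by norm_num) hlt
        omega
      have memf : ∀ z, true ∈ f (strNum p) z ↔ some [true] ∈ U p (strEquiv.symm z) := by
        intro z
        simp [f]
      obtain ⟨l, hl, hlf⟩ := hTf (strNum p) (u n) fun z _ => by
        refine ⟨by simpa [f] using htot (strEquiv.symm z), fun hz => ?_⟩
        rcases hcons _ _ ((memf z).1 hz) with h | h
        · rw [← strEquiv_symm_mem]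
          simpa [chi] using h
        · simp at h
      refine hxT _ hj l hl (hlf x hxu ((memf x).2 ?_))
      have : chi A (strEquiv.symm x) = true := by simpa [chi] using strEquiv_symm_mem.2 hxA
      rwa [this] at hpx
  -- Instance complexity is finite at every element of `A` but unbounded on this set, by `key`.
  refine ⟨c, Set.Infinite.of_image (fun x => (instComplexity U x A).toNat)
    (Set.infinite_of_not_bddAbove ?_)⟩
  rintro ⟨b, hb⟩
  obtain ⟨x, hxA, hxC, hxI⟩ := key (b + 1)
  have hle := hb ⟨x, ⟨hxA, hxC.trans (add_le_add_left hxI _)⟩, rfl⟩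
  have := (ENat.toNat_le_toNat hxI (hU.instComplexity_ne_top hxA)).trans hle
  simp only [ENat.toNat_natCast] at this
  omega
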